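/- Let $L,L_d>0$, $\Omega=(-L/2,L/2)$, $\overline\Omega=[-L/2,L/2]$ and $\kappa_0^2=\pi^2/L^2+L_d^{-2}$. Let $U$ (zonal wind) and $Q'$ (potential vorticity gradient) be real $C^1$ functions on $\overline\Omega$. Let $\alpha\in\mathbb R$ be such that the reciprocal Rossby Mach number $$M_\alpha^{-1}(y)=\frac{1}{\kappa_0^2}\,\frac{Q'(y)}{U(y)-\alpha}$$ is continuous on $\overline\Omega$; that is, $\{U\neq\alpha\}$ is dense in $\overline\Omega$ and the quotient extends from it to a continuous function on $\overline\Omega$, again denoted $M_\alpha^{-1}$. Let $H^1_0$ be the space of complex-valued absolutely continuous functions $\phi$ on $\overline\Omega$ with $\phi'\in L^2(\Omega)$ and $\phi(\pm L/2)=0$, and for $0\ne\phi\in H^1_0$ put $$R_\alpha(\phi)=\frac{\int_\Omega\{|\phi'|^2+(L_d^{-2}-\kappa_0^2M_\alpha^{-1})|\phi|^2\}\,dy}{\int_\Omega|\phi|^2\,dy}.$$ If there is a nonzero $g\in H^1_0$ with $R_\alpha(g)\le 0$, then there are $\lambda_0\le 0$ and a nonzero $\psi\in C^2(\overline\Omega)$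 with $\psi(\pm L/2)=0$ such that: (1) $\psi$ is a neutral mode with phase speed $c=c_r=\alpha$ and wavenumber $k_0=\sqrt{-\lambda_0}\ge 0$: $\psi''-(k_0^2+L_d^{-2})\psi+\frac{Q'}{U-\alpha}\psi=0$ at all points of $\Omega$ where $U\ne\alpha$; (2) $\lambda_0=R_\alpha(\psi)$ is the minimum of $R_\alpha$ over the nonzero elements of $H_0^1$, and every minimiser is a constant multiple of $\psi$; (3) $\psi$ is the ground state of the regular Sturm–Liouville problem $-\psi''+(L_d^{-2}-\kappa_0^2M_\alpha^{-1})\psi=\lambda\psi$ on $\Omega$, $\psi(\pm L/2)=0$: the potential is continuous on $\overline\Omega$, $\psi$ is an eigenfunction with eigenvalue $\lambda_0$, and $\lambda_0$ is the smallest (real) eigenvalue. -/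

import Mathlib

open MeasureTheory Set

noncomputable section

namespace RossbyChannel

/-- The closed channel `[-L/2, L/2]`. -/
def channel (L : ℝ) : Set ℝ := Icc (-(L / 2)) (L / 2)

/-- The open channel `Ω = (-L/2, L/2)`. -/
def openChannel (L : ℝ) : Set ℝ := Ioo (-(L / 2)) (L / 2)

/-- `κ₀² = π² / L² + L_d⁻²`. -/
def kappaSq (L Ld : ℝ) : ℝ := Real.pi ^ 2 / L ^ 2 + (Ld ^ 2)⁻¹

/-- The reciprocal Rossby Mach number `κ₀⁻² Q' / (U - α)` of the zonal wind `U` and the potential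
vorticity gradient `Q' = dQ` becomes the continuous function `M` on the closed channel: the
quotient makes sense on a dense subset of the channel, and `M` is its continuous extension.
(So `M` is uniquely determined on the channel by `U`, `dQ` and `α`.) -/
structure IsReciprocalMach (L Ld : ℝ) (U dQ : ℝ → ℝ) (α : ℝ) (M : ℝ → ℝ) : Prop where
  continuousOn : ContinuousOn M (channel L)
  eq_div : ∀ y ∈ channel L, U y ≠ α → M y = 1 / kappaSq L Ld * (dQ y / (U y - α))
  dense : channel L ⊆ closure {y ∈ channel L | U y ≠ α}

/-- `C₀²`: twice continuously differentiable up to the boundary, with zero boundary values. -/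
structure MemC20 (L : ℝ) (f : ℝ → ℂ) : Prop where
  contDiffOn : ContDiffOn ℝ 2 f (channel L)
  left : f (-(L / 2)) = 0
  right : f (L / 2) = 0

/-- `H₀¹`: absolutely continuous on the closed channel (hence differentiable almost everywhere and
square integrable), with square integrable derivative and zero boundary values. -/
structure MemH10 (L : ℝ) (f : ℝ → ℂ) : Prop where
  absCont : AbsolutelyContinuousOnInterval f (-(L / 2)) (L / 2)
  memLp_deriv : MemLp (deriv f) 2 (volume.restrict (openChannel L))
  left : f (-(L / 2)) = 0
  right : f (L / 2) = 0

/-- `f` is not identically zero on the channel. -/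
def Nontriv (L : ℝ) (f : ℝ → ℂ) : Prop := ∃ y ∈ channel L, f y ≠ 0

/-- The potential `L_d⁻² - κ₀² M_α⁻¹`. -/
def potential (L Ld : ℝ) (M : ℝ → ℝ) (y : ℝ) : ℝ := (Ld ^ 2)⁻¹ - kappaSq L Ld * M y

/-- The Rayleigh quotient `∫ (|f'|² + q |f|²) / ∫ |f|²` over the channel, for a potential `q`. -/
def rayleigh (L : ℝ) (q : ℝ → ℝ) (f : ℝ → ℂ) : ℝ :=
  (∫ y in (-(L / 2))..(L / 2), (‖deriv f y‖ ^ 2 + q y * ‖f y‖ ^ 2)) /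
    (∫ y in (-(L / 2))..(L / 2), ‖f y‖ ^ 2)

/-- `f` is an eigenfunction, with eigenvalue `lam`, of the Sturm–Liouville problem
`-f'' + q f = lam f` on the channel with Dirichlet boundary conditions.
The problem is regular when `q` is continuous on the closed channel. -/
structure IsSLEigenfunction (L : ℝ) (q : ℝ → ℝ) (lam : ℝ) (f : ℝ → ℂ) : Prop where
  memC20 : MemC20 L f
  nontriv : Nontriv L f
  eqn : ∀ y ∈ openChannel L, -deriv (deriv f) y + (q y : ℂ) * f y = (lam : ℂ) * f y

/-- `f` is a normal mode (an eigenfunction in `C₀²`) with wavenumber `k ≥ 0` and complex phase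
speed `c`: it solves `f'' - (k² + L_d⁻²) f + Q' / (U - c) f = 0` in the channel. The equation is
imposed wherever `U ≠ c`; as `f` is `C²`, it passes to limits of such points. -/
structure IsMode (L Ld : ℝ) (U dQ : ℝ → ℝ) (k : ℝ) (c : ℂ) (f : ℝ → ℂ) : Prop where
  wavenumber_nonneg : 0 ≤ k
  memC20 : MemC20 L f
  nontriv : Nontriv L f
  eqn : ∀ y ∈ openChannel L, (U y : ℂ) ≠ c →
    deriv (deriv f) y - ((k : ℂ) ^ 2 + ((Ld : ℂ) ^ 2)⁻¹) * f y
      + (dQ y : ℂ) / ((U y : ℂ) - c) * f y = 0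

/-- A neutral mode: a mode whose phase speed is the real number `cr` (that is, `c_i = 0`). -/
def IsNeutralMode (L Ld : ℝ) (U dQ : ℝ → ℝ) (k cr : ℝ) (f : ℝ → ℂ) : Prop :=
  IsMode L Ld U dQ k (cr : ℂ) f

end RossbyChannel

end

/-! The ground state is found by shooting rather than by compactness. Write `q` for the potential
and let `u'' = (q - λ) u`, `u = 0` at the left end; its Prüfer angle `θ` starts at `0`, crosses
multiples of `π` only upwards, and its value at the right end depends continuously on `λ`
(Grönwall). For very negative `λ` that value is below `π`; if it is at least `π` for some other `λ`,
an intermediate `λ₀` gives exactly `π`, that is, a Dirichlet eigenfunction positive inside.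

Picone's identity is used twice. If `u > 0` inside, it writes `∫ (φ'² + (q - λ) φ²)` as the integral
of a square plus boundary terms, which vanish for `φ` in `H₀¹`; hence `λ ≤ R(φ)`. At `λ = 1` this
contradicts `R(g) ≤ 0`, so the angle there has reached `π`. At `λ₀` it gives minimality, and
vanishing of the square gives uniqueness. Complex `φ` splits into real and imaginary parts. Finally
`λ₀ ≤ R(g) ≤ 0` makes the wavenumber real, and every eigenvalue is a Rayleigh quotient, so `λ₀` is
the smallest. -/

noncomputable section

open Filter Topology

/-! ### Absolute continuity and boundary terms -/

/-- A function with a continuous derivative on a compact interval is absolutely continuous. -/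
theorem absolutelyContinuousOnInterval_of_hasDerivAt {f f' : ℝ → ℝ} {a b : ℝ} (hab : a ≤ b)
    (hf : ∀ y ∈ Icc a b, HasDerivAt f (f' y) y) (hf' : ContinuousOn f' (Icc a b)) :
    AbsolutelyContinuousOnInterval f a b := by
  obtain ⟨C, hC⟩ := isCompact_Icc.exists_bound_of_continuousOn hf'
  have : LipschitzOnWith C.toNNReal f (uIcc a b) := by
    rw [uIcc_of_le hab]
    refine (convex_Icc a b).lipschitzOnWith_of_nnnorm_hasDerivWithin_le
      (fun y hy => (hf y hy).hasDerivWithinAt) fun y hy => ?_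
    rw [← NNReal.coe_le_coe, coe_nnnorm]
    exact (hC y hy).trans (Real.le_coe_toNNReal C)
  exact this.absolutelyContinuousOnInterval

/-- One-dimensional Cauchy–Schwarz bound for an absolutely continuous function vanishing at `e`. -/
theorem AbsolutelyContinuousOnInterval.sq_div_le_abs_integral_sq_deriv {f : ℝ → ℝ} {e y : ℝ}
    (hf : AbsolutelyContinuousOnInterval f e y) (he : f e = 0) (hey : y ≠ e)
    (hf2 : IntervalIntegrable (fun x => deriv f x ^ 2) volume e y) :
    f y ^ 2 / |y - e| ≤ |∫ x in e..y, deriv f x ^ 2| := by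
  have hne : y - e ≠ 0 := sub_ne_zero.2 hey
  have h1 := hf.integral_deriv_eq_sub
  rw [he, sub_zero] at h1
  have hi := hf.intervalIntegrable_deriv
  -- `c` is the mean of `f'` between `e` and `y`; expanding the integral of `(f' - c)²` gives the
  -- bound, on either side of `e`.
  set c := f y / (y - e) with hc
  have key : ∫ x in e..y, (deriv f x - c) ^ 2 = (∫ x in e..y, deriv f x ^ 2) - f y ^ 2 / (y - e) := by
    have : ∀ x, (deriv f x - c) ^ 2 = deriv f x ^ 2 - (2 * c) * deriv f x + c ^ 2 := fun x => by ring
    simp_rw [this]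
    rw [intervalIntegral.integral_add (hf2.sub (hi.const_mul _)) (by simp),
      intervalIntegral.integral_sub hf2 (hi.const_mul _), intervalIntegral.integral_const_mul, h1,
      intervalIntegral.integral_const, hc, smul_eq_mul]
    field_simp
    ring
  rcases lt_or_gt_of_ne hey with h | h
  · have h2 : ∫ x in e..y, (deriv f x - c) ^ 2 ≤ 0 := by
      rw [intervalIntegral.integral_symm, neg_nonpos]
      exact intervalIntegral.integral_nonneg h.le fun x _ => sq_nonneg _
    have h3 : |y - e| = -(y - e) := abs_of_neg (by linarith)
    rw [h3, div_neg]
    refine le_trans ?_ (neg_le_abs _)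
    linarith
  · have h2 : 0 ≤ ∫ x in e..y, (deriv f x - c) ^ 2 :=
      intervalIntegral.integral_nonneg h.le fun x _ => sq_nonneg _
    rw [abs_of_pos (by linarith : 0 < y - e)]
    refine le_trans ?_ (le_abs_self _)
    linarith

/-- The boundary term in Picone's identity vanishes at an end point where `φ = 0`. -/
theorem tendsto_sq_mul_logDeriv_zero {φ u v : ℝ → ℝ} {a b e : ℝ} (he : e ∈ uIcc a b)
    (hφ : AbsolutelyContinuousOnInterval φ a b) (hφe : φ e = 0)
    (hφ2 : IntervalIntegrable (fun x => deriv φ x ^ 2) volume a b)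
    (hu : HasDerivAt u (v e) e) (hv : ContinuousAt v e) (hne : u e ≠ 0 ∨ v e ≠ 0) :
    Tendsto (fun y => φ y * φ y * (v y / u y)) (𝓝[uIcc a b \ {e}] e) (𝓝 0) := by
  have hle : 𝓝[uIcc a b \ {e}] e ≤ 𝓝[uIcc a b] e := nhdsWithin_mono _ sdiff_subset
  have hle' : 𝓝[uIcc a b \ {e}] e ≤ 𝓝 e := nhdsWithin_le_nhds
  have hv' := hv.tendsto.mono_left hle'
  by_cases hue : u e = 0
  · have hve : v e ≠ 0 := hne.resolve_left (not_not.2 hue)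
    have hs : Tendsto (fun y => slope u e y) (𝓝[uIcc a b \ {e}] e) (𝓝 (v e)) :=
      (hasDerivAt_iff_tendsto_slope.1 hu).mono_left (nhdsWithin_mono _ fun y hy => hy.2)
    have hI : Tendsto (fun y => ∫ x in e..y, deriv φ x ^ 2) (𝓝[uIcc a b \ {e}] e) (𝓝 0) := by
      have := (intervalIntegral.continuousOn_primitive_interval' hφ2 he) e he
      simpa using this.tendsto.mono_left hle
    have hq : Tendsto (fun y => φ y ^ 2 / |y - e|) (𝓝[uIcc a b \ {e}] e) (𝓝 0) := by
      have hI' := hI.abs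
      rw [abs_zero] at hI'
      refine tendsto_of_tendsto_of_tendsto_of_le_of_le' tendsto_const_nhds hI'
        (Eventually.of_forall fun y => by positivity) ?_
      filter_upwards [self_mem_nhdsWithin] with y hy
      have hsub : uIcc e y ⊆ uIcc a b := uIcc_subset_uIcc he hy.1
      exact (hφ.mono hsub).sq_div_le_abs_integral_sq_deriv hφe hy.2 (hφ2.mono_set hsub)
    -- Near a zero of `u`, `φ² v / u` is `φ² / |y - e|` divided by the slope of `u` and times `v`,
    -- up to sign; the slope tends to `v e ≠ 0`.
    have hlim := (hq.mul ((hs.inv₀ hve).abs)).mul hv'.abs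
    rw [zero_mul, zero_mul] at hlim
    rw [tendsto_zero_iff_abs_tendsto_zero]
    refine hlim.congr' ?_
    filter_upwards [self_mem_nhdsWithin] with y hy
    have hye : |y - e| ≠ 0 := abs_ne_zero.2 (sub_ne_zero.2 hy.2)
    simp only [Function.comp, slope_def_field, hue, sub_zero, abs_mul, abs_div, abs_inv]
    by_cases h0 : |u y| = 0
    · simp [h0]
    · rw [← sq_abs]; field_simp
  · have h1 : Tendsto φ (𝓝[uIcc a b \ {e}] e) (𝓝 0) := by
      rw [← hφe]
      exact (hφ.continuousOn e he).tendsto.mono_left hle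
    have := (h1.mul h1).mul (hv'.div (hu.continuousAt.tendsto.mono_left hle') hue)
    simpa using this

/-! ### Picone's identity and Jacobi's inequality -/

/-- A positive-on-the-interior solution `u` of `u'' = r u` on `[a, b]`, with derivative `v`. -/
structure IsPositiveSolution (r u v : ℝ → ℝ) (a b : ℝ) : Prop where
  lt : a < b
  contr : ContinuousOn r (Icc a b)
  deriv_u : ∀ y ∈ Icc a b, HasDerivAt u (v y) y
  deriv_v : ∀ y ∈ Icc a b, HasDerivAt v (r y * u y) y
  pos : ∀ y ∈ Ioo a b, 0 < u y
  ne_left : u a ≠ 0 ∨ v a ≠ 0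
  ne_right : u b ≠ 0 ∨ v b ≠ 0

/-- A real function in `H₀¹(a, b)`. -/
structure IsRealH10 (φ : ℝ → ℝ) (a b : ℝ) : Prop where
  ac : AbsolutelyContinuousOnInterval φ a b
  sq : IntervalIntegrable (fun x => deriv φ x ^ 2) volume a b
  left : φ a = 0
  right : φ b = 0

section Picone

variable {r u v φ : ℝ → ℝ} {a b s t : ℝ}

theorem IsPositiveSolution.intervalIntegrable (hu : IsPositiveSolution r u v a b)
    (hφ : IsRealH10 φ a b) :
    IntervalIntegrable (fun x => deriv φ x ^ 2 + r x * φ x ^ 2) volume a b := by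
  refine hφ.sq.add (ContinuousOn.intervalIntegrable ?_)
  refine ContinuousOn.mul ?_ (hφ.ac.continuousOn.pow 2)
  rw [uIcc_of_le hu.lt.le]
  exact hu.contr

/-- Picone's identity on a compact subinterval of the interior. -/
theorem IsPositiveSolution.picone (hu : IsPositiveSolution r u v a b) (hφ : IsRealH10 φ a b)
    (hs : a < s) (hst : s ≤ t) (ht : t < b) :
    ∫ x in s..t, (deriv φ x ^ 2 + r x * φ x ^ 2) =
      (∫ x in s..t, (deriv φ x - v x / u x * φ x) ^ 2) +
        (φ t * φ t * (v t / u t) - φ s * φ s * (v s / u s)) ∧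
    IntervalIntegrable (fun x => (deriv φ x - v x / u x * φ x) ^ 2) volume s t ∧
    AbsolutelyContinuousOnInterval (fun x => φ x / u x) s t := by
  have hsub : Icc s t ⊆ Icc a b := Icc_subset_Icc hs.le ht.le
  have hpos : ∀ y ∈ Icc s t, 0 < u y := fun y hy => hu.pos y ⟨hs.trans_le hy.1, hy.2.trans_lt ht⟩
  have huc : ContinuousOn u (Icc s t) := fun y hy =>
    (hu.deriv_u y (hsub hy)).continuousAt.continuousWithinAt
  have hvc : ContinuousOn v (Icc s t) := fun y hy =>
    (hu.deriv_v y (hsub hy)).continuousAt.continuousWithinAt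
  have hrc := hu.contr.mono hsub
  have hu0 : ∀ y ∈ Icc s t, u y ≠ 0 := fun y hy => (hpos y hy).ne'
  -- Riccati equation for `p = v / u`: `p' = r - p²`.
  have hp : ∀ y ∈ Icc s t, HasDerivAt (fun x => v x / u x) (r y - (v y / u y) ^ 2) y := by
    intro y hy
    have h := (hu.deriv_v y (hsub hy)).div (hu.deriv_u y (hsub hy)) (hu0 y hy)
    convert! h using 1
    have := hu0 y hy
    field_simp
  have hpac : AbsolutelyContinuousOnInterval (fun x => v x / u x) s t :=
    absolutelyContinuousOnInterval_of_hasDerivAt hst hp (hrc.sub ((hvc.div huc hu0).pow 2))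
  have hiac : AbsolutelyContinuousOnInterval (fun x => (u x)⁻¹) s t :=
    absolutelyContinuousOnInterval_of_hasDerivAt hst
      (fun y hy => (hu.deriv_u y (hsub hy)).inv (hu0 y hy))
      (hvc.neg.div (huc.pow 2) fun y hy => pow_ne_zero 2 (hu0 y hy))
  have hsub' : uIcc s t ⊆ uIcc a b := by rwa [uIcc_of_le hst, uIcc_of_le hu.lt.le]
  have hφac := hφ.ac.mono hsub'
  have hF := (hφac.fun_mul hφac).fun_mul hpac
  have hI := (hu.intervalIntegrable hφ).mono_set hsub'
  -- By Riccati, `(φ² p)' = 2 φ φ' p + φ² (r - p²)`; subtracting it completes the square.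
  have hae : ∀ᵐ x, x ∈ uIoc s t → (deriv φ x - v x / u x * φ x) ^ 2 =
      (deriv φ x ^ 2 + r x * φ x ^ 2) - deriv (fun x => φ x * φ x * (v x / u x)) x := by
    filter_upwards [hφac.ae_differentiableAt] with x hx hxst
    have hx' : x ∈ uIcc s t := uIoc_subset_uIcc hxst
    have h1 := (hx hx').hasDerivAt
    have h2 := hp x (by rwa [uIcc_of_le hst] at hx')
    have h3 : HasDerivAt (fun x => φ x * φ x * (v x / u x)) _ x := (h1.mul h1).mul h2
    rw [h3.deriv]
    simp only [Pi.mul_apply]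
    ring
  have hres : (fun x => (deriv φ x ^ 2 + r x * φ x ^ 2) -
      deriv (fun x => φ x * φ x * (v x / u x)) x) =ᵐ[volume.restrict (uIoc s t)]
      fun x => (deriv φ x - v x / u x * φ x) ^ 2 := by
    rw [EventuallyEq, ae_restrict_iff' measurableSet_uIoc]
    filter_upwards [hae] with x hx hx' using (hx hx').symm
  refine ⟨?_, (hI.sub hF.intervalIntegrable_deriv).congr_ae hres, ?_⟩
  · rw [intervalIntegral.integral_congr_ae hae,
      intervalIntegral.integral_sub hI hF.intervalIntegrable_deriv, hF.integral_deriv_eq_sub]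
    ring
  · simpa only [div_eq_mul_inv] using hφac.fun_mul hiac

/-- Picone on `[s, t]` leaves boundary terms. These are absorbed by the energies over `[a, s]` and
`[t, b]`: there the square is dropped and the outer end tends to `a` or `b`, where the boundary term
vanishes. -/
theorem IsPositiveSolution.integral_sq_le (hu : IsPositiveSolution r u v a b)
    (hφ : IsRealH10 φ a b) (hs : a < s) (hst : s ≤ t) (ht : t < b) :
    ∫ x in s..t, (deriv φ x - v x / u x * φ x) ^ 2 ≤
      ∫ x in a..b, (deriv φ x ^ 2 + r x * φ x ^ 2) := by
  have hI := hu.intervalIntegrable hφ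
  have hab := uIcc_of_le hu.lt.le
  have hsa : s ∈ uIcc a b := by rw [hab]; exact ⟨hs.le, hst.trans ht.le⟩
  have hta : t ∈ uIcc a b := by rw [hab]; exact ⟨hs.le.trans hst, ht.le⟩
  have hIas := hI.mono_set (uIcc_subset_uIcc left_mem_uIcc hsa)
  have hIst := hI.mono_set (uIcc_subset_uIcc hsa hta)
  have hItb := hI.mono_set (uIcc_subset_uIcc hta right_mem_uIcc)
  have hmono : ∀ x y, a < x → x ≤ y → y < b →
      φ y * φ y * (v y / u y) - φ x * φ x * (v x / u x) ≤
        ∫ z in x..y, (deriv φ z ^ 2 + r z * φ z ^ 2) := by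
    intro x y hx hxy hy
    rw [(hu.picone hφ hx hxy hy).1]
    linarith [intervalIntegral.integral_nonneg (μ := volume) hxy
      fun z (_ : z ∈ Icc x y) => sq_nonneg (deriv φ z - v z / u z * φ z)]
  have hleft : φ s * φ s * (v s / u s) ≤ ∫ z in a..s, (deriv φ z ^ 2 + r z * φ z ^ 2) := by
    have h1 : Tendsto (fun y => φ y * φ y * (v y / u y)) (𝓝[>] a) (𝓝 0) := by
      refine (tendsto_sq_mul_logDeriv_zero left_mem_uIcc hφ.ac hφ.left hφ.sq
        (hu.deriv_u a ⟨le_rfl, hu.lt.le⟩) (hu.deriv_v a ⟨le_rfl, hu.lt.le⟩).continuousAt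
        hu.ne_left).mono_left ?_
      rw [← nhdsWithin_Ioo_eq_nhdsGT hu.lt]
      refine nhdsWithin_mono _ fun y hy => ⟨?_, hy.1.ne'⟩
      rw [hab]; exact Ioo_subset_Icc_self hy
    have h2 : Tendsto (fun y => ∫ z in y..s, (deriv φ z ^ 2 + r z * φ z ^ 2)) (𝓝[>] a)
        (𝓝 (∫ z in a..s, (deriv φ z ^ 2 + r z * φ z ^ 2))) := by
      have h := (intervalIntegral.continuousOn_primitive_interval' hI hsa) a left_mem_uIcc
      have h' := (h.tendsto.mono_left (show 𝓝[Ioo a b] a ≤ 𝓝[uIcc a b] a from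
        nhdsWithin_mono _ (by rw [hab]; exact Ioo_subset_Icc_self))).neg
      rw [nhdsWithin_Ioo_eq_nhdsGT hu.lt] at h'
      simpa only [← intervalIntegral.integral_symm] using h'
    have h3 := le_of_tendsto_of_tendsto (tendsto_const_nhds.sub h1) h2 (by
      filter_upwards [Ioo_mem_nhdsGT hs] with y hy
      exact hmono y s hy.1 hy.2.le (hst.trans_lt ht))
    simpa using h3
  have hright : -(φ t * φ t * (v t / u t)) ≤ ∫ z in t..b, (deriv φ z ^ 2 + r z * φ z ^ 2) := by
    have h1 : Tendsto (fun y => φ y * φ y * (v y / u y)) (𝓝[<] b) (𝓝 0) := by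
      refine (tendsto_sq_mul_logDeriv_zero right_mem_uIcc hφ.ac hφ.right hφ.sq
        (hu.deriv_u b ⟨hu.lt.le, le_rfl⟩) (hu.deriv_v b ⟨hu.lt.le, le_rfl⟩).continuousAt
        hu.ne_right).mono_left ?_
      rw [← nhdsWithin_Ioo_eq_nhdsLT hu.lt]
      refine nhdsWithin_mono _ fun y hy => ⟨?_, hy.2.ne⟩
      rw [hab]; exact Ioo_subset_Icc_self hy
    have h2 : Tendsto (fun y => ∫ z in t..y, (deriv φ z ^ 2 + r z * φ z ^ 2)) (𝓝[<] b)
        (𝓝 (∫ z in t..b, (deriv φ z ^ 2 + r z * φ z ^ 2))) := by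
      have h := (intervalIntegral.continuousOn_primitive_interval' hI hta) b right_mem_uIcc
      have h' := h.tendsto.mono_left (show 𝓝[Ioo a b] b ≤ 𝓝[uIcc a b] b from
        nhdsWithin_mono _ (by rw [hab]; exact Ioo_subset_Icc_self))
      rwa [nhdsWithin_Ioo_eq_nhdsLT hu.lt] at h'
    have h3 := le_of_tendsto_of_tendsto (h1.sub tendsto_const_nhds) h2 (by
      filter_upwards [Ioo_mem_nhdsLT ht] with y hy
      exact hmono t y (hs.trans_le hst) hy.1.le hy.2)
    simpa using h3
  rw [← intervalIntegral.integral_add_adjacent_intervals (hIas.trans hIst) hItb,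
    ← intervalIntegral.integral_add_adjacent_intervals hIas hIst]
  linarith [(hu.picone hφ hs hst ht).1]

/-- The degenerate interval `s = t` suffices, the integral of the square over it being `0`. -/
theorem IsPositiveSolution.energy_nonneg (hu : IsPositiveSolution r u v a b)
    (hφ : IsRealH10 φ a b) : 0 ≤ ∫ x in a..b, (deriv φ x ^ 2 + r x * φ x ^ 2) := by
  have h := hu.lt
  have := hu.integral_sq_le hφ (s := (a + b) / 2) (t := (a + b) / 2) (by linarith) le_rfl
    (by linarith)
  simpa using this

/-- Equality in Jacobi's inequality forces proportionality. -/
theorem IsPositiveSolution.eq_mul_of_energy_nonpos (hu : IsPositiveSolution r u v a b)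
    (hua : u a = 0) (hub : u b = 0) (hφ : IsRealH10 φ a b)
    (hE : ∫ x in a..b, (deriv φ x ^ 2 + r x * φ x ^ 2) ≤ 0) :
    ∃ c : ℝ, ∀ y ∈ Icc a b, φ y = c * u y := by
  have hab := hu.lt
  -- The square must vanish almost everywhere, so `(φ / u)' = 0` almost everywhere, and absolute
  -- continuity makes `φ / u` constant.
  have hconst : ∀ s t, a < s → s ≤ t → t < b → φ s / u s = φ t / u t := by
    intro s t hs hst ht
    obtain ⟨-, hint, hac⟩ := hu.picone hφ hs hst ht
    have h0 : ∫ x in s..t, (deriv φ x - v x / u x * φ x) ^ 2 = 0 :=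
      le_antisymm ((hu.integral_sq_le hφ hs hst ht).trans hE)
        (intervalIntegral.integral_nonneg hst fun x _ => sq_nonneg _)
    rw [intervalIntegral.integral_eq_zero_iff_of_le_of_nonneg_ae hst
      (Eventually.of_forall fun x => sq_nonneg _) hint, EventuallyEq,
      ae_restrict_iff' measurableSet_Ioc] at h0
    have hsub' : uIcc s t ⊆ uIcc a b := by
      rw [uIcc_of_le hst, uIcc_of_le hu.lt.le]; exact Icc_subset_Icc hs.le ht.le
    obtain ⟨C, hC⟩ := hac.const_of_ae_hasDerivAt_zero (by
      filter_upwards [h0, (hφ.ac.mono hsub').ae_differentiableAt, (by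
        simp [ae_iff, measure_singleton] : ∀ᵐ x : ℝ, x ≠ s)] with x hx hxd hxs hxm
      rw [uIcc_of_le hst] at hxm hxd
      have h1 := (hxd hxm).hasDerivAt
      have hux : u x ≠ 0 := (hu.pos x ⟨hs.trans_le hxm.1, hxm.2.trans_lt ht⟩).ne'
      have h2 := hu.deriv_u x ⟨hs.le.trans hxm.1, hxm.2.trans ht.le⟩
      convert! h1.div h2 hux using 1
      have h3 := pow_eq_zero_iff two_ne_zero |>.1 (hx ⟨lt_of_le_of_ne hxm.1 hxs.symm, hxm.2⟩)
      rw [sub_eq_zero.1 h3]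
      field_simp
      ring)
    rw [hC s left_mem_uIcc, hC t right_mem_uIcc]
  refine ⟨φ ((a + b) / 2) / u ((a + b) / 2), fun y hy => ?_⟩
  rcases hy.1.eq_or_lt with rfl | h1
  · rw [hφ.left, hua, mul_zero]
  rcases hy.2.eq_or_lt with rfl | h2
  · rw [hφ.right, hub, mul_zero]
  have hq : φ y / u y = φ ((a + b) / 2) / u ((a + b) / 2) := by
    rcases le_total y ((a + b) / 2) with h | h
    · exact hconst _ _ h1 h (by linarith)
    · exact (hconst _ _ (by linarith) h h2).symm
  rw [← hq, div_mul_cancel₀ _ (hu.pos y ⟨h1, h2⟩).ne']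

end Picone

/-! ### The Prüfer angle -/

/-- The right-hand side of the Prüfer equation `θ' = cos² θ - ρ sin² θ`. -/
def pruferField (ρ x : ℝ) : ℝ := Real.cos x ^ 2 - ρ * Real.sin x ^ 2

theorem abs_pruferField_le {ρ C : ℝ} (hρ : |ρ| ≤ C) (x : ℝ) : |pruferField ρ x| ≤ 1 + C := by
  have h1 := Real.cos_sq_le_one x
  have h2 := Real.sin_sq_le_one x
  have h3 : |ρ * Real.sin x ^ 2| ≤ C * 1 := by
    rw [abs_mul, abs_of_nonneg (sq_nonneg (Real.sin x))]
    exact mul_le_mul hρ h2 (sq_nonneg _) ((abs_nonneg _).trans hρ)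
  refine (abs_sub _ _).trans ?_
  rw [abs_of_nonneg (sq_nonneg (Real.cos x))]
  linarith

theorem lipschitzWith_pruferField {ρ C : ℝ} (hρ : |ρ| ≤ C) :
    LipschitzWith (2 * (1 + C)).toNNReal (pruferField ρ) := by
  have hd : ∀ x, HasDerivAt (pruferField ρ)
      (-(2 * (1 + ρ) * (Real.sin x * Real.cos x))) x := by
    intro x
    have h := ((Real.hasDerivAt_cos x).pow 2).sub (((Real.hasDerivAt_sin x).pow 2).const_mul ρ)
    convert! h using 1
    simp
    ring
  refine lipschitzWith_of_nnnorm_deriv_le (fun x => (hd x).differentiableAt) fun x => ?_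
  rw [(hd x).deriv, ← NNReal.coe_le_coe, coe_nnnorm, Real.norm_eq_abs]
  refine le_trans ?_ (Real.le_coe_toNNReal _)
  rw [abs_neg, abs_mul, abs_mul, abs_mul, abs_two]
  have h1 : |Real.sin x| * |Real.cos x| ≤ 1 :=
    mul_le_one₀ (Real.abs_sin_le_one x) (abs_nonneg _) (Real.abs_cos_le_one x)
  have h2 : |1 + ρ| ≤ 1 + C := (abs_add_le _ _).trans (by rw [abs_one]; linarith)
  have h3 : 0 ≤ |1 + ρ| := abs_nonneg _
  nlinarith [mul_nonneg (abs_nonneg (Real.sin x)) (abs_nonneg (Real.cos x))]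

/-- `θ` is the Prüfer angle of `u'' = ρ u`, `u a = 0`, on a neighbourhood of `[a, b]`. -/
structure IsPruferAngle (ρ θ : ℝ → ℝ) (a b : ℝ) : Prop where
  init : θ a = 0
  deriv : ∀ y ∈ Ioo (a - 1) (b + 1), HasDerivAt θ (pruferField (ρ y) (θ y)) y

/-- The field is bounded by `1 + C` and globally Lipschitz in the angle, so one Picard–Lindelöf step
covers `[a - 1, b + 1]`: the radius `(1 + C) (b - a + 1)` is the largest possible drift. The unit
margins give two-sided derivatives at `a` and `b`. -/
theorem exists_isPruferAngle {ρ : ℝ → ℝ} (hρ : Continuous ρ) {C : ℝ} (hC : ∀ y, |ρ y| ≤ C)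
    {a b : ℝ} (hab : a ≤ b) : ∃ θ, IsPruferAngle ρ θ a b := by
  have hC0 : 0 ≤ C := (abs_nonneg _).trans (hC 0)
  have hPL : IsPicardLindelof (fun t x => pruferField (ρ t) x) (tmin := a - 1) (tmax := b + 1)
      ⟨a, by constructor <;> linarith⟩ 0 ((1 + C) * (b - a + 1)).toNNReal 0 (1 + C).toNNReal
      (2 * (1 + C)).toNNReal := by
    refine ⟨fun t _ => (lipschitzWith_pruferField (hC t)).lipschitzOnWith, fun x _ => ?_,
      fun t _ x _ => ?_, ?_⟩
    · unfold pruferField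
      fun_prop
    · rw [Real.norm_eq_abs]
      exact (abs_pruferField_le (hC t) x).trans (Real.le_coe_toNNReal _)
    · rw [Real.coe_toNNReal _ (by linarith), Real.coe_toNNReal _ (by nlinarith)]
      simp only [NNReal.coe_zero, sub_zero]
      gcongr
      apply max_le <;> linarith
  obtain ⟨θ, h0, hθ⟩ := hPL.exists_eq_forall_mem_Icc_hasDerivWithinAt₀
  exact ⟨θ, h0, fun y hy => (hθ y (Ioo_subset_Icc_self hy)).hasDerivAt (Icc_mem_nhds hy.1 hy.2)⟩

namespace IsPruferAngle

variable {ρ θ : ℝ → ℝ} {a b : ℝ}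

theorem hasDerivAt_of_mem_Icc (h : IsPruferAngle ρ θ a b) {y : ℝ} (hy : y ∈ Icc a b) :
    HasDerivAt θ (pruferField (ρ y) (θ y)) y :=
  h.deriv y ⟨by linarith [hy.1], by linarith [hy.2]⟩

/-- The Prüfer angle crosses every multiple of `π` upwards. -/
theorem lt_of_le (h : IsPruferAngle ρ θ a b) (n : ℕ) {s y : ℝ} (has : a ≤ s) (hs : n * Real.pi ≤ θ s)
    (hsy : s < y) (hyb : y ≤ b) : n * Real.pi < θ y := by
  have hd : ∀ z ∈ Ico s (b + 1), HasDerivAt θ (pruferField (ρ z) (θ z)) z := fun z hz =>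
    h.deriv z ⟨by linarith [hz.1], hz.2⟩
  -- At a multiple of `π` the sine vanishes, so the slope is `1` whatever the coefficient.
  have hone : ∀ z, n * Real.pi = θ z → pruferField (ρ z) (θ z) = 1 := by
    intro z hz
    rw [pruferField, ← hz, Real.sin_nat_mul_pi, Real.cos_sq', Real.sin_nat_mul_pi]
    simp
  -- Going past `b` makes `y = b` an interior point; touching the level at `y` would then be a local
  -- minimum, with slope `0` instead of `1`.
  have hge : ∀ z ∈ Icc s (b + 1 / 2), n * Real.pi ≤ θ z := by
    intro z hz
    exact image_le_of_deriv_right_lt_deriv_boundary' (f := fun _ => n * Real.pi) (f' := fun _ => 0)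
      continuousOn_const (fun x _ => hasDerivWithinAt_const _ _ _) hs
      (fun x hx => (hd x ⟨hx.1, by linarith [hx.2]⟩).continuousAt.continuousWithinAt)
      (fun x hx => (hd x ⟨hx.1, by linarith [hx.2]⟩).hasDerivWithinAt)
      (fun x _ hx => by rw [hone x hx]; norm_num) hz
  refine lt_of_le_of_ne (hge y ⟨hsy.le, by linarith⟩) fun heq => ?_
  have hmin : IsLocalMin θ y := by
    filter_upwards [Icc_mem_nhds hsy (by linarith : y < b + 1 / 2)] with z hz
    rw [← heq]
    exact hge z hz
  have := hmin.hasDerivAt_eq_zero (hd y ⟨hsy.le, by linarith⟩)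
  rw [hone y heq] at this
  exact one_ne_zero this

theorem pos (h : IsPruferAngle ρ θ a b) {y : ℝ} (hy : y ∈ Ioc a b) : 0 < θ y := by
  simpa using h.lt_of_le 0 le_rfl (by simp [h.init]) hy.1 hy.2

theorem lt_pi (h : IsPruferAngle ρ θ a b) (hb : θ b ≤ Real.pi) {y : ℝ} (hy : y ∈ Ico a b) :
    θ y < Real.pi := by
  by_contra! hge
  have := h.lt_of_le 1 hy.1 (by simpa using hge) hy.2 le_rfl
  simp only [Nat.cast_one, one_mul] at this
  linarith

/-- If the coefficient is larger than one, then the solution does not oscillate. -/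
theorem lt_pi_of_one_lt (h : IsPruferAngle ρ θ a b) (hab : a ≤ b) (hρ : ∀ y, 1 < ρ y) :
    θ b < Real.pi := by
  have hpi := Real.pi_pos
  -- Barrier at `3π/4`: there `cos² = sin² = 1/2`, and the slope `(1 - ρ) / 2` is negative.
  have h1 : θ b ≤ Real.pi - Real.pi / 4 :=
    image_le_of_deriv_right_lt_deriv_boundary (B := fun _ => Real.pi - Real.pi / 4) (B' := fun _ => 0)
      (fun x hx => (h.hasDerivAt_of_mem_Icc hx).continuousAt.continuousWithinAt)
      (fun x hx => (h.hasDerivAt_of_mem_Icc (Ico_subset_Icc_self hx)).hasDerivWithinAt)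
      (by rw [h.init]; linarith) (fun x => hasDerivAt_const _ _)
      (fun x _ hx => by
        rw [hx, pruferField, Real.sin_pi_sub, Real.cos_pi_sub, Real.sin_pi_div_four,
          Real.cos_pi_div_four, neg_sq, div_pow, Real.sq_sqrt (by norm_num)]
        linarith [hρ x]) (right_mem_Icc.2 hab)
  linarith

/-- Since `sin² ≤ 1`, `η` solves the equation of `θ` up to an error `ε`; Grönwall does the rest. -/
theorem dist_le (h : IsPruferAngle ρ θ a b) {σ η : ℝ → ℝ} (h' : IsPruferAngle σ η a b)
    (hab : a ≤ b) {C ε : ℝ} (hC : ∀ y, |ρ y| ≤ C) (hε : ∀ y, |σ y - ρ y| ≤ ε) :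
    dist (θ b) (η b) ≤ gronwallBound 0 (2 * (1 + C)).toNNReal ε (b - a) := by
  have := dist_le_of_approx_trajectories_ODE (v := fun t x => pruferField (ρ t) x) (a := a) (b := b)
    (εf := 0) (εg := ε) (δ := 0)
    (fun t => lipschitzWith_pruferField (hC t))
    (fun x hx => (h.hasDerivAt_of_mem_Icc hx).continuousAt.continuousWithinAt)
    (fun x hx => (h.hasDerivAt_of_mem_Icc (Ico_subset_Icc_self hx)).hasDerivWithinAt)
    (fun x _ => by simp)
    (fun x hx => (h'.hasDerivAt_of_mem_Icc hx).continuousAt.continuousWithinAt)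
    (fun x hx => (h'.hasDerivAt_of_mem_Icc (Ico_subset_Icc_self hx)).hasDerivWithinAt)
    (fun x _ => by
      rw [Real.dist_eq, pruferField, pruferField]
      have : Real.cos (η x) ^ 2 - σ x * Real.sin (η x) ^ 2 -
          (Real.cos (η x) ^ 2 - ρ x * Real.sin (η x) ^ 2) =
          -((σ x - ρ x) * Real.sin (η x) ^ 2) := by ring
      rw [this, abs_neg, abs_mul, abs_of_nonneg (sq_nonneg (Real.sin (η x)))]
      exact (mul_le_of_le_one_right (abs_nonneg _) (Real.sin_sq_le_one _)).trans (hε x))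
    (by simp [h.init, h'.init]) b (right_mem_Icc.2 hab)
  simpa using this

/-- The solution `u = R sin θ` of `u'' = ρ u` belonging to a Prüfer angle. -/
theorem exists_solution (h : IsPruferAngle ρ θ a b) (hρ : Continuous ρ) (hab : a ≤ b) :
    ∃ R u v : ℝ → ℝ, (∀ y, 0 < R y) ∧ (∀ y, u y = R y * Real.sin (θ y)) ∧
      (∀ y, v y = R y * Real.cos (θ y)) ∧
      (∀ y ∈ Ioo (a - 1) (b + 1), HasDerivAt u (v y) y) ∧
      (∀ y ∈ Ioo (a - 1) (b + 1), HasDerivAt v (ρ y * u y) y) := by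
  set I := Ioo (a - 1) (b + 1)
  -- `f` is the logarithmic derivative of the amplitude, so `R = exp ∫ f` is positive.
  set f : ℝ → ℝ := fun y => (1 + ρ y) * (Real.sin (θ y) * Real.cos (θ y)) with hf
  have hθc : ContinuousOn θ I := fun y hy => (h.deriv y hy).continuousAt.continuousWithinAt
  have hfc : ContinuousOn f I := by
    have := Real.continuous_sin.comp_continuousOn hθc
    have := Real.continuous_cos.comp_continuousOn hθc
    exact (continuous_const.add hρ).continuousOn.mul (ContinuousOn.mul ‹_› ‹_›)
  have ha : a ∈ I := ⟨by linarith, by linarith⟩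
  have hR : ∀ y ∈ I, HasDerivAt (fun y => Real.exp (∫ x in a..y, f x))
      (Real.exp (∫ x in a..y, f x) * f y) y := by
    intro y hy
    refine HasDerivAt.exp (intervalIntegral.integral_hasDerivAt_right ?_
      (hfc.stronglyMeasurableAtFilter isOpen_Ioo y hy) (hfc.continuousAt (isOpen_Ioo.mem_nhds hy)))
    exact (hfc.mono (ordConnected_Ioo.uIcc_subset ha hy)).intervalIntegrable
  refine ⟨fun y => Real.exp (∫ x in a..y, f x), _, _, fun y => Real.exp_pos _, fun y => rfl,
    fun y => rfl, fun y hy => ?_, fun y hy => ?_⟩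
  · convert! (hR y hy).mul (h.deriv y hy).sin using 1
    simp only [hf, pruferField]
    linear_combination (-Real.exp (∫ x in a..y, f x) * Real.cos (θ y)) * Real.sin_sq_add_cos_sq (θ y)
  · convert! (hR y hy).mul (h.deriv y hy).cos using 1
    simp only [hf, pruferField]
    linear_combination (-Real.exp (∫ x in a..y, f x) * Real.sin (θ y) * ρ y) * Real.sin_sq_add_cos_sq (θ y)

theorem exists_isPositiveSolution (h : IsPruferAngle ρ θ a b) (hρ : Continuous ρ) (hab : a < b)
    (hb : θ b ≤ Real.pi) :
    ∃ u v : ℝ → ℝ, IsPositiveSolution ρ u v a b ∧ u a = 0 ∧ (θ b = Real.pi → u b = 0) ∧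
      (∀ y ∈ Ioo (a - 1) (b + 1), HasDerivAt u (v y) y) ∧
      (∀ y ∈ Ioo (a - 1) (b + 1), HasDerivAt v (ρ y * u y) y) := by
  obtain ⟨R, u, v, hR, hu, hv, hu', hv'⟩ := h.exists_solution hρ hab.le
  have hsub : Icc a b ⊆ Ioo (a - 1) (b + 1) := fun y hy =>
    ⟨by linarith [hy.1], by linarith [hy.2]⟩
  have hne : ∀ y, u y ≠ 0 ∨ v y ≠ 0 := by
    intro y
    by_contra! hcon
    rw [hu, hv] at hcon
    have h1 := (mul_eq_zero.1 hcon.1).resolve_left (hR y).ne'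
    have h2 := (mul_eq_zero.1 hcon.2).resolve_left (hR y).ne'
    have := Real.sin_sq_add_cos_sq (θ y)
    rw [h1, h2] at this
    norm_num at this
  refine ⟨u, v, ⟨hab, hρ.continuousOn, fun y hy => hu' y (hsub hy), fun y hy => hv' y (hsub hy),
    fun y hy => ?_, hne a, hne b⟩, ?_, fun hpi => ?_, hu', hv'⟩
  · rw [hu]
    exact mul_pos (hR y) (Real.sin_pos_of_pos_of_lt_pi (h.pos (Ioo_subset_Ioc_self hy))
      (h.lt_pi hb (Ioo_subset_Ico_self hy)))
  · rw [hu, h.init, Real.sin_zero, mul_zero]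
  · rw [hu, hpi, Real.sin_pi, mul_zero]

end IsPruferAngle

/-! ### The ground state by shooting -/

/-- Existence of the ground state: if no solution for the spectral parameter `lam1` is positive on
`(a, b)` without vanishing at `b`, then some `lam` carries a positive Dirichlet eigenfunction. -/
theorem exists_ground_state {q : ℝ → ℝ} (hq : Continuous q) {Q : ℝ} (hQ : ∀ y, |q y| ≤ Q)
    {a b : ℝ} (hab : a < b) {lam1 : ℝ}
    (hlam1 : ∀ u v, ¬ IsPositiveSolution (fun y => q y - lam1) u v a b) :
    ∃ (lam : ℝ) (u v : ℝ → ℝ), IsPositiveSolution (fun y => q y - lam) u v a b ∧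
      u a = 0 ∧ u b = 0 ∧ (∀ y ∈ Ioo (a - 1) (b + 1), HasDerivAt u (v y) y) ∧
      (∀ y ∈ Ioo (a - 1) (b + 1), HasDerivAt v ((q y - lam) * u y) y) := by
  have hcont : ∀ lam : ℝ, Continuous fun y => q y - lam := fun lam => hq.sub continuous_const
  have hbd : ∀ lam y, |q y - lam| ≤ Q + |lam| := fun lam y =>
    (abs_sub _ _).trans (by linarith [hQ y])
  choose θ hθ using fun lam : ℝ => exists_isPruferAngle (hcont lam) (hbd lam) hab.le
  have hΦ : Continuous fun lam => θ lam b := by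
    rw [continuous_iff_continuousAt]
    intro lam
    rw [ContinuousAt, tendsto_iff_dist_tendsto_zero]
    have hlim : Tendsto (fun μ : ℝ => gronwallBound 0 (2 * (1 + (Q + |lam|))).toNNReal |μ - lam|
        (b - a)) (𝓝 lam) (𝓝 0) := by
      have hc : Continuous fun μ : ℝ => gronwallBound 0 (2 * (1 + (Q + |lam|))).toNNReal |μ - lam|
        (b - a) := (gronwallBound_continuous_ε _ _ _).comp
          (continuous_abs.comp (continuous_id.sub continuous_const))
      have := hc.tendsto lam
      rwa [sub_self, abs_zero, gronwallBound_ε0_δ0] at this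
    refine squeeze_zero (fun _ => dist_nonneg) (fun μ => ?_) hlim
    rw [dist_comm]
    refine (hθ lam).dist_le (hθ μ) hab.le (hbd lam) fun y => ?_
    rw [abs_sub_comm]
    exact le_of_eq (by congr 1; ring)
  -- An angle below `π` at `b` would stay in `(0, π)` inside and give a forbidden positive solution.
  have hhi : Real.pi ≤ θ lam1 b := by
    by_contra! hlt
    obtain ⟨u, v, hu, -⟩ := (hθ lam1).exists_isPositiveSolution (hcont lam1) hab hlt.le
    exact hlam1 u v hu
  -- With this parameter the coefficient `q + Q + 2` is at least `2`, hence above `1`.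
  have hlo : θ (-Q - 2) b ≤ Real.pi := by
    refine ((hθ (-Q - 2)).lt_pi_of_one_lt hab.le fun y => ?_).le
    linarith [neg_abs_le (q y), hQ y]
  obtain ⟨lam, hlam⟩ := mem_range_of_exists_le_of_exists_ge hΦ ⟨_, hlo⟩ ⟨_, hhi⟩
  obtain ⟨u, v, hu, hua, hub, hu', hv'⟩ :=
    (hθ lam).exists_isPositiveSolution (hcont lam) hab (le_of_eq hlam)
  exact ⟨lam, u, v, hu, hua, hub hlam, hu', hv'⟩

theorem contDiffOn_two_of_hasDerivAt {u v w : ℝ → ℝ} {I : Set ℝ} (hI : IsOpen I)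
    (hu : ∀ y ∈ I, HasDerivAt u (v y) y) (hv : ∀ y ∈ I, HasDerivAt v (w y) y)
    (hw : ContinuousOn w I) : ContDiffOn ℝ 2 u I := by
  have hv1 : ContDiffOn ℝ 1 v I := by
    rw [show (1 : WithTop ℕ∞) = 0 + 1 by norm_num, contDiffOn_succ_iff_deriv_of_isOpen hI]
    refine ⟨fun y hy => (hv y hy).differentiableAt.differentiableWithinAt, by simp, ?_⟩
    exact contDiffOn_zero.2 (hw.congr fun y hy => (hv y hy).deriv)
  rw [show (2 : WithTop ℕ∞) = 1 + 1 by norm_num, contDiffOn_succ_iff_deriv_of_isOpen hI]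
  refine ⟨fun y hy => (hu y hy).differentiableAt.differentiableWithinAt, by simp, ?_⟩
  exact hv1.congr fun y hy => (hu y hy).deriv

/-- Extending `q` by its end values makes it continuous and bounded on `ℝ`; the solution then lives
on a neighbourhood of `[a, b]`, hence is `C²` up to the boundary. -/
theorem exists_ground_state_of_continuousOn {q : ℝ → ℝ} {a b : ℝ} (hab : a < b)
    (hq : ContinuousOn q (Icc a b)) {lam1 : ℝ}
    (hlam1 : ∀ u v, ¬ IsPositiveSolution (fun y => q y - lam1) u v a b) :
    ∃ (lam : ℝ) (u v : ℝ → ℝ), IsPositiveSolution (fun y => q y - lam) u v a b ∧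
      u a = 0 ∧ u b = 0 ∧ ContDiffOn ℝ 2 u (Icc a b) := by
  set p : ℝ → ℝ := IccExtend hab.le ((Icc a b).domRestrict q)
  have hp : Continuous p := (continuousOn_iff_continuous_domRestrict.1 hq).Icc_extend'
  have hpq : ∀ y ∈ Icc a b, p y = q y := fun y hy => IccExtend_of_mem hab.le _ hy
  obtain ⟨Q, hQ⟩ := isCompact_Icc.exists_bound_of_continuousOn hq
  have hpQ : ∀ y, |p y| ≤ Q := fun y => hQ _ (projIcc a b hab.le y).2
  have hcongr : ∀ lam u v, IsPositiveSolution (fun y => p y - lam) u v a b →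
      IsPositiveSolution (fun y => q y - lam) u v a b := fun lam u v h =>
    { h with
      contr := hq.sub continuousOn_const
      deriv_v := fun y hy => by
        have := h.deriv_v y hy
        simpa only [hpq y hy] using this }
  obtain ⟨lam, u, v, hu, hua, hub, hu', hv'⟩ := exists_ground_state hp hpQ hab
    (fun u v h => hlam1 u v (hcongr _ u v h))
  refine ⟨lam, u, v, hcongr _ u v hu, hua, hub, ?_⟩
  refine (contDiffOn_two_of_hasDerivAt isOpen_Ioo hu' hv' ?_).mono
    fun y hy => ⟨by linarith [hy.1], by linarith [hy.2]⟩
  exact (hp.sub continuous_const).continuousOn.mul fun y hy =>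
    (hu' y hy).continuousAt.continuousWithinAt

/-- Composition with a map that does not increase distances preserves absolute continuity. -/
theorem AbsolutelyContinuousOnInterval.comp_of_dist_le {X Y : Type*} [PseudoMetricSpace X]
    [PseudoMetricSpace Y] {f : ℝ → X} {a b : ℝ} (hf : AbsolutelyContinuousOnInterval f a b)
    (g : X → Y) (hg : ∀ x y, dist (g x) (g y) ≤ dist x y) :
    AbsolutelyContinuousOnInterval (fun x => g (f x)) a b := by
  rw [absolutelyContinuousOnInterval_iff] at hf ⊢
  intro ε hε
  obtain ⟨δ, hδ, h⟩ := hf ε hε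
  exact ⟨δ, hδ, fun E hE hd => (Finset.sum_le_sum fun i _ => hg _ _).trans_lt (h E hE hd)⟩

/-! ### Complex functions and the Rayleigh quotient -/

namespace RossbyChannel

variable {L : ℝ} {q : ℝ → ℝ} {f : ℝ → ℂ}

theorem left_lt_right (hL : 0 < L) : -(L / 2) < L / 2 := by linarith

theorem MemH10.ac_re (hf : MemH10 L f) :
    AbsolutelyContinuousOnInterval (fun x => (f x).re) (-(L / 2)) (L / 2) :=
  hf.absCont.comp_of_dist_le Complex.re fun x y => by
    rw [Real.dist_eq, ← Complex.sub_re, dist_eq_norm]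
    exact Complex.abs_re_le_norm _

theorem MemH10.ac_im (hf : MemH10 L f) :
    AbsolutelyContinuousOnInterval (fun x => (f x).im) (-(L / 2)) (L / 2) :=
  hf.absCont.comp_of_dist_le Complex.im fun x y => by
    rw [Real.dist_eq, ← Complex.sub_im, dist_eq_norm]
    exact Complex.abs_im_le_norm _

theorem MemH10.ae_deriv (hf : MemH10 L f) : ∀ᵐ x, x ∈ uIoc (-(L / 2)) (L / 2) →
    deriv f x = ⟨deriv (fun x => (f x).re) x, deriv (fun x => (f x).im) x⟩ := by
  filter_upwards [hf.ac_re.ae_differentiableAt, hf.ac_im.ae_differentiableAt] with x h1 h2 hx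
  have hx' := uIoc_subset_uIcc hx
  have h3 := (h1 hx').hasDerivAt.ofReal_comp.add
    ((h2 hx').hasDerivAt.ofReal_comp.mul_const Complex.I)
  have h4 : HasDerivAt f _ x := h3.congr_of_eventuallyEq
    (Eventually.of_forall fun y => (Complex.re_add_im (f y)).symm)
  rw [h4.deriv]
  exact Complex.ext (by simp) (by simp)

theorem MemH10.isRealH10_re (hL : 0 < L) (hf : MemH10 L f) :
    IsRealH10 (fun x => (f x).re) (-(L / 2)) (L / 2) := by
  refine ⟨hf.ac_re, ?_, by simp [hf.left], by simp [hf.right]⟩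
  have h : IntervalIntegrable (fun x => (deriv f x).re ^ 2) volume (-(L / 2)) (L / 2) :=
    (intervalIntegrable_iff_integrableOn_Ioo_of_le (left_lt_right hL).le).2
      hf.memLp_deriv.re.integrable_sq
  refine h.congr_ae ?_
  rw [EventuallyEq, ae_restrict_iff' measurableSet_uIoc]
  filter_upwards [hf.ae_deriv] with x hx hx'
  rw [hx hx']

theorem MemH10.isRealH10_im (hL : 0 < L) (hf : MemH10 L f) :
    IsRealH10 (fun x => (f x).im) (-(L / 2)) (L / 2) := by
  refine ⟨hf.ac_im, ?_, by simp [hf.left], by simp [hf.right]⟩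
  have h : IntervalIntegrable (fun x => (deriv f x).im ^ 2) volume (-(L / 2)) (L / 2) :=
    (intervalIntegrable_iff_integrableOn_Ioo_of_le (left_lt_right hL).le).2
      hf.memLp_deriv.im.integrable_sq
  refine h.congr_ae ?_
  rw [EventuallyEq, ae_restrict_iff' measurableSet_uIoc]
  filter_upwards [hf.ae_deriv] with x hx hx'
  rw [hx hx']

theorem MemH10.continuousOn (hL : 0 < L) (hf : MemH10 L f) : ContinuousOn f (channel L) := by
  have := hf.absCont.continuousOn
  rwa [uIcc_of_le (left_lt_right hL).le] at this

theorem MemH10.integral_sq_pos (hL : 0 < L) (hf : MemH10 L f) (hnt : Nontriv L f) :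
    0 < ∫ y in (-(L / 2))..(L / 2), ‖f y‖ ^ 2 := by
  obtain ⟨y, hy, hne⟩ := hnt
  exact intervalIntegral.integral_pos (left_lt_right hL) ((hf.continuousOn hL).norm.pow 2)
    (fun x _ => sq_nonneg _) ⟨y, hy, by positivity⟩

/-- The energy of a complex function is the sum of the energies of its real and imaginary parts. -/
theorem MemH10.energy_eq (hL : 0 < L) (hq : ContinuousOn q (channel L)) (hf : MemH10 L f)
    (lam : ℝ) :
    (∫ y in (-(L / 2))..(L / 2), (‖deriv f y‖ ^ 2 + q y * ‖f y‖ ^ 2)) -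
        lam * ∫ y in (-(L / 2))..(L / 2), ‖f y‖ ^ 2 =
      (∫ y in (-(L / 2))..(L / 2),
        (deriv (fun x => (f x).re) y ^ 2 + (q y - lam) * (f y).re ^ 2)) +
      ∫ y in (-(L / 2))..(L / 2),
        (deriv (fun x => (f x).im) y ^ 2 + (q y - lam) * (f y).im ^ 2) := by
  have hle := (left_lt_right hL).le
  have hq' : ContinuousOn q (uIcc (-(L / 2)) (L / 2)) := by rwa [uIcc_of_le hle]
  have hfc : ContinuousOn f (uIcc (-(L / 2)) (L / 2)) := hf.absCont.continuousOn
  have hqc : ContinuousOn (fun y => q y - lam) (uIcc (-(L / 2)) (L / 2)) :=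
    hq'.sub continuousOn_const
  have h1 : IntervalIntegrable (fun y => deriv (fun x => (f x).re) y ^ 2 +
      (q y - lam) * (f y).re ^ 2) volume (-(L / 2)) (L / 2) := (hf.isRealH10_re hL).sq.add
    (hqc.mul (hf.ac_re.continuousOn.pow 2)).intervalIntegrable
  have h2 : IntervalIntegrable (fun y => deriv (fun x => (f x).im) y ^ 2 +
      (q y - lam) * (f y).im ^ 2) volume (-(L / 2)) (L / 2) := (hf.isRealH10_im hL).sq.add
    (hqc.mul (hf.ac_im.continuousOn.pow 2)).intervalIntegrable
  have hD : IntervalIntegrable (fun y => lam * ‖f y‖ ^ 2) volume (-(L / 2)) (L / 2) :=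
    (continuousOn_const.mul (hfc.norm.pow 2)).intervalIntegrable
  have hnorm : ∀ z : ℂ, ‖z‖ ^ 2 = z.re ^ 2 + z.im ^ 2 := fun z => by
    rw [Complex.sq_norm, Complex.normSq_apply]; ring
  have hN : ∫ y in (-(L / 2))..(L / 2), (‖deriv f y‖ ^ 2 + q y * ‖f y‖ ^ 2) =
      ∫ y in (-(L / 2))..(L / 2),
        ((deriv (fun x => (f x).re) y ^ 2 + (q y - lam) * (f y).re ^ 2 +
        (deriv (fun x => (f x).im) y ^ 2 + (q y - lam) * (f y).im ^ 2)) + lam * ‖f y‖ ^ 2) := by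
    refine intervalIntegral.integral_congr_ae ?_
    filter_upwards [hf.ae_deriv] with x hx hx'
    rw [hnorm, hnorm, hx hx']
    ring
  rw [hN, intervalIntegral.integral_add (h1.add h2) hD, intervalIntegral.integral_add h1 h2,
    intervalIntegral.integral_const_mul]
  ring

theorem MemC20.memH10 (hL : 0 < L) (hf : MemC20 L f) : MemH10 L f := by
  have hlt := left_lt_right hL
  have h1 : ContDiffOn ℝ 1 f (channel L) := hf.contDiffOn.of_le (by norm_num)
  refine ⟨?_, ?_, hf.left, hf.right⟩
  · apply ContDiffOn.absolutelyContinuousOnInterval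
    rwa [uIcc_of_le hlt.le]
  · have hd : ContinuousOn (derivWithin f (channel L)) (channel L) :=
      h1.continuousOn_derivWithin (uniqueDiffOn_Icc hlt) le_rfl
    obtain ⟨C, hC⟩ := isCompact_Icc.exists_bound_of_continuousOn hd
    -- Only inside: at the end points `deriv` depends on values outside the channel.
    have heq : ∀ y ∈ openChannel L, derivWithin f (channel L) y = deriv f y := fun y hy =>
      derivWithin_of_mem_nhds (Icc_mem_nhds hy.1 hy.2)
    have hdo : ContinuousOn (deriv f) (openChannel L) :=
      (hd.mono Ioo_subset_Icc_self).congr fun y hy => (heq y hy).symm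
    have : IsFiniteMeasure (volume.restrict (openChannel L)) :=
      ⟨by rw [Measure.restrict_apply_univ, openChannel, Real.volume_Ioo]; exact ENNReal.ofReal_lt_top⟩
    refine MemLp.of_bound (hdo.aestronglyMeasurable measurableSet_Ioo) C ?_
    refine (ae_restrict_iff' measurableSet_Ioo).2 (Eventually.of_forall fun y hy => ?_)
    rw [← heq y hy]
    exact hC y (Ioo_subset_Icc_self hy)

/-- The Rayleigh quotient of an eigenfunction is its eigenvalue. -/
theorem IsSLEigenfunction.rayleigh_eq (hL : 0 < L) (hq : ContinuousOn q (channel L)) {lam : ℝ}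
    (hf : IsSLEigenfunction L q lam f) : rayleigh L q f = lam := by
  have hlt := left_lt_right hL
  have huniq : UniqueDiffOn ℝ (channel L) := uniqueDiffOn_Icc hlt
  set d := derivWithin f (channel L) with hd
  have hfc : ContinuousOn f (channel L) := hf.memC20.contDiffOn.continuousOn
  have hd1 : ContDiffOn ℝ 1 d (channel L) :=
    hf.memC20.contDiffOn.derivWithin huniq (by norm_num)
  have hdc := hd1.continuousOn
  have hnhds : ∀ y ∈ openChannel L, channel L ∈ 𝓝 y := fun y hy => Icc_mem_nhds hy.1 hy.2
  have heq : ∀ y ∈ openChannel L, d y = deriv f y := fun y hy =>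
    derivWithin_of_mem_nhds (hnhds y hy)
  have hf' : ∀ y ∈ openChannel L, HasDerivAt f (d y) y := fun y hy => by
    rw [heq y hy]
    exact ((hf.memC20.contDiffOn.differentiableOn (by norm_num) y
      (Ioo_subset_Icc_self hy)).differentiableAt (hnhds y hy)).hasDerivAt
  have hd' : ∀ y ∈ openChannel L, HasDerivAt d (((q y - lam : ℝ) : ℂ) * f y) y := fun y hy => by
    have h1 := ((hd1.differentiableOn (by norm_num) y
      (Ioo_subset_Icc_self hy)).differentiableAt (hnhds y hy)).hasDerivAt
    have h2 : deriv d y = deriv (deriv f) y := EventuallyEq.deriv_eq (by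
      filter_upwards [isOpen_Ioo.mem_nhds hy] with z hz using heq z hz)
    have h3 := hf.eqn y hy
    convert! h1 using 1
    rw [h2]
    push_cast
    linear_combination h3
  -- Integration by parts: the integrand is the derivative of the real inner product of `f` and
  -- `f'`, which vanishes at both ends.
  have hint : ∫ y in (-(L / 2))..(L / 2), (‖d y‖ ^ 2 + (q y - lam) * ‖f y‖ ^ 2) = 0 := by
    have hc : ContinuousOn (fun y => ‖d y‖ ^ 2 + (q y - lam) * ‖f y‖ ^ 2) (channel L) :=
      (hdc.norm.pow 2).add ((hq.sub continuousOn_const).mul (hfc.norm.pow 2))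
    rw [intervalIntegral.integral_eq_sub_of_hasDerivAt_of_le
      (f := fun y => inner ℝ (f y) (d y)) hlt.le (hfc.inner hdc) (fun y hy => ?_)
      (hc.intervalIntegrable_of_Icc hlt.le)]
    · rw [hf.memC20.left, hf.memC20.right, inner_zero_left, inner_zero_left, sub_zero]
    · convert! (hf' y hy).inner ℝ (hd' y hy) using 1
      rw [← Complex.real_smul, inner_smul_right, real_inner_self_eq_norm_sq,
        real_inner_self_eq_norm_sq]
      ring
  have hN : ∫ y in (-(L / 2))..(L / 2), (‖deriv f y‖ ^ 2 + q y * ‖f y‖ ^ 2) =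
      ∫ y in (-(L / 2))..(L / 2), (‖d y‖ ^ 2 + (q y - lam) * ‖f y‖ ^ 2 + lam * ‖f y‖ ^ 2) := by
    refine intervalIntegral.integral_congr_ae ?_
    filter_upwards [(by simp [ae_iff, measure_singleton] : ∀ᵐ x : ℝ, x ≠ L / 2)] with x hx hxm
    rw [uIoc_of_le hlt.le] at hxm
    rw [heq x ⟨hxm.1, lt_of_le_of_ne hxm.2 hx⟩]
    ring
  have hpos := (hf.memC20.memH10 hL).integral_sq_pos hL hf.nontriv
  rw [rayleigh, hN, intervalIntegral.integral_add, hint, zero_add,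
    intervalIntegral.integral_const_mul, mul_div_cancel_right₀ _ hpos.ne']
  · exact ((hdc.norm.pow 2).add ((hq.sub continuousOn_const).mul
      (hfc.norm.pow 2))).intervalIntegrable_of_Icc hlt.le
  · exact (continuousOn_const.mul (hfc.norm.pow 2)).intervalIntegrable_of_Icc hlt.le

variable {u v : ℝ → ℝ} {lam : ℝ}

/-- Jacobi's inequality for the real and imaginary parts. As `u` need not vanish at the ends, this
also serves to exclude positive solutions at a parameter above `R(g)`. -/
theorem le_rayleigh (hL : 0 < L) (hq : ContinuousOn q (channel L))
    (hu : IsPositiveSolution (fun y => q y - lam) u v (-(L / 2)) (L / 2))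
    (hf : MemH10 L f) (hnt : Nontriv L f) : lam ≤ rayleigh L q f := by
  rw [rayleigh, le_div_iff₀ (hf.integral_sq_pos hL hnt), ← sub_nonneg, hf.energy_eq hL hq lam]
  exact add_nonneg (hu.energy_nonneg (hf.isRealH10_re hL)) (hu.energy_nonneg (hf.isRealH10_im hL))

/-- Two nonnegative energies with sum `0` both vanish; the two real factors form one complex factor.
-/
theorem eq_mul_of_rayleigh_eq (hL : 0 < L) (hq : ContinuousOn q (channel L))
    (hu : IsPositiveSolution (fun y => q y - lam) u v (-(L / 2)) (L / 2))
    (hua : u (-(L / 2)) = 0) (hub : u (L / 2) = 0)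
    (hf : MemH10 L f) (hnt : Nontriv L f) (hR : rayleigh L q f = lam) :
    ∃ a : ℂ, ∀ y ∈ channel L, f y = a * (u y : ℂ) := by
  rw [rayleigh, div_eq_iff (hf.integral_sq_pos hL hnt).ne', ← sub_eq_zero,
    hf.energy_eq hL hq lam] at hR
  have h1 := hu.energy_nonneg (hf.isRealH10_re hL)
  have h2 := hu.energy_nonneg (hf.isRealH10_im hL)
  obtain ⟨c, hc⟩ := hu.eq_mul_of_energy_nonpos hua hub (hf.isRealH10_re hL) (by linarith)
  obtain ⟨d, hd⟩ := hu.eq_mul_of_energy_nonpos hua hub (hf.isRealH10_im hL) (by linarith)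
  exact ⟨⟨c, d⟩, fun y hy => Complex.ext (by simpa using hc y hy) (by simpa using hd y hy)⟩

theorem isSLEigenfunction_ofReal (hL : 0 < L)
    (hu : IsPositiveSolution (fun y => q y - lam) u v (-(L / 2)) (L / 2))
    (hua : u (-(L / 2)) = 0) (hub : u (L / 2) = 0) (hu2 : ContDiffOn ℝ 2 u (channel L)) :
    IsSLEigenfunction L q lam fun y => (u y : ℂ) := by
  refine ⟨⟨Complex.ofRealCLM.contDiff.comp_contDiffOn hu2, by simp [hua], by simp [hub]⟩,
    ⟨0, ⟨by linarith, by linarith⟩, ?_⟩, fun y hy => ?_⟩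
  · exact Complex.ofReal_ne_zero.2 (hu.pos 0 ⟨by linarith, by linarith⟩).ne'
  · have h1 : deriv (fun y => (u y : ℂ)) =ᶠ[𝓝 y] fun y => (v y : ℂ) := by
      filter_upwards [isOpen_Ioo.mem_nhds hy] with z hz
      exact (hu.deriv_u z (Ioo_subset_Icc_self hz)).ofReal_comp.deriv
    rw [h1.deriv_eq, (hu.deriv_v y (Ioo_subset_Icc_self hy)).ofReal_comp.deriv]
    push_cast
    ring

theorem kappaSq_pos {Ld : ℝ} (hL : 0 < L) : 0 < kappaSq L Ld := by
  have := Real.pi_pos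
  unfold kappaSq
  positivity

/-- A Dirichlet eigenfunction with non-positive eigenvalue is a neutral mode. -/
theorem IsSLEigenfunction.isNeutralMode {Ld α : ℝ} {U dQ M : ℝ → ℝ} (hL : 0 < L)
    (hM : IsReciprocalMach L Ld U dQ α M) (hlam : lam ≤ 0)
    (hf : IsSLEigenfunction L (potential L Ld M) lam f) :
    IsNeutralMode L Ld U dQ (Real.sqrt (-lam)) α f := by
  refine ⟨Real.sqrt_nonneg _, hf.memC20, hf.nontriv, fun y hy hne => ?_⟩
  have hne' : U y ≠ α := fun h => hne (by rw [h])
  have hk : ((Real.sqrt (-lam) : ℝ) : ℂ) ^ 2 = -(lam : ℂ) := by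
    rw [← Complex.ofReal_pow, Real.sq_sqrt (by linarith), Complex.ofReal_neg]
  have hp : potential L Ld M y = (Ld ^ 2)⁻¹ - dQ y / (U y - α) := by
    have := (kappaSq_pos (Ld := Ld) hL).ne'
    rw [potential, hM.eq_div y (Ioo_subset_Icc_self hy) hne', ← mul_assoc, mul_one_div_cancel this,
      one_mul]
  have h := hf.eqn y hy
  rw [hp] at h
  push_cast at h
  rw [hk]
  linear_combination -h

end RossbyChannel

end

/-! ### The main theorem -/

theorem theorem2 (L Ld : ℝ) (hL : 0 < L) (hLd : 0 < Ld) (U dQ : ℝ → ℝ)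
    (hU : ContDiffOn ℝ 1 U (RossbyChannel.channel L))
    (hdQ : ContDiffOn ℝ 1 dQ (RossbyChannel.channel L))
    (α : ℝ) (M : ℝ → ℝ) (hM : RossbyChannel.IsReciprocalMach L Ld U dQ α M)
    (hg : ∃ g : ℝ → ℂ, RossbyChannel.MemH10 L g ∧ RossbyChannel.Nontriv L g ∧
      RossbyChannel.rayleigh L (RossbyChannel.potential L Ld M) g ≤ 0) :
    ∃ (lam0 : ℝ) (ψ : ℝ → ℂ),
      lam0 ≤ 0 ∧
      -- `ψ` is a neutral mode with phase speed `α` and wavenumber `√(-lam0)`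
      RossbyChannel.IsNeutralMode L Ld U dQ (Real.sqrt (-lam0)) α ψ ∧
      -- `ψ` is the minimiser of the Rayleigh quotient over the nonzero elements of `H₀¹`,
      -- with minimum `lam0`, unique up to a constant factor
      RossbyChannel.MemH10 L ψ ∧
      RossbyChannel.rayleigh L (RossbyChannel.potential L Ld M) ψ = lam0 ∧
      (∀ φ : ℝ → ℂ, RossbyChannel.MemH10 L φ → RossbyChannel.Nontriv L φ →
        lam0 ≤ RossbyChannel.rayleigh L (RossbyChannel.potential L Ld M) φ) ∧
      (∀ φ : ℝ → ℂ, RossbyChannel.MemH10 L φ → RossbyChannel.Nontriv L φ →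
        RossbyChannel.rayleigh L (RossbyChannel.potential L Ld M) φ = lam0 →
        ∃ a : ℂ, ∀ y ∈ RossbyChannel.channel L, φ y = a * ψ y) ∧
      -- `ψ` is the ground state of a regular Sturm–Liouville problem
      ContinuousOn (RossbyChannel.potential L Ld M) (RossbyChannel.channel L) ∧
      RossbyChannel.IsSLEigenfunction L (RossbyChannel.potential L Ld M) lam0 ψ ∧
      IsLeast {lam : ℝ | ∃ φ : ℝ → ℂ,
        RossbyChannel.IsSLEigenfunction L (RossbyChannel.potential L Ld M) lam φ} lam0 := by
  obtain ⟨g, hg, hgnt, hgR⟩ := hg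
  have hq : ContinuousOn (RossbyChannel.potential L Ld M) (RossbyChannel.channel L) :=
    continuousOn_const.sub (continuousOn_const.mul hM.continuousOn)
  -- Any positive `lam1` would do: a positive solution there would force `R(g) ≥ lam1 > 0`.
  obtain ⟨lam0, u, v, hu, hua, hub, hu2⟩ := exists_ground_state_of_continuousOn (lam1 := 1)
    (RossbyChannel.left_lt_right hL) hq
    (fun u v hu => by linarith [RossbyChannel.le_rayleigh hL hq hu hg hgnt])
  have hψ := RossbyChannel.isSLEigenfunction_ofReal hL hu hua hub hu2
  have hlam0 : lam0 ≤ 0 := (RossbyChannel.le_rayleigh hL hq hu hg hgnt).trans hgR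
  refine ⟨lam0, fun y => (u y : ℂ), hlam0, hψ.isNeutralMode hL hM hlam0, hψ.memC20.memH10 hL,
    hψ.rayleigh_eq hL hq, fun φ hφ hnt => RossbyChannel.le_rayleigh hL hq hu hφ hnt,
    fun φ hφ hnt hR => RossbyChannel.eq_mul_of_rayleigh_eq hL hq hu hua hub hφ hnt hR, hq, hψ,
    ⟨_, hψ⟩, ?_⟩
  rintro lam ⟨φ, hφ⟩
  rw [← hφ.rayleigh_eq hL hq]
  exact RossbyChannel.le_rayleigh hL hq hu (hφ.memC20.memH10 hL) hφ.nontriv
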